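/- Let $\Bbbk$ be an arbitrary field. A left-symmetric algebra is a $\Bbbk$-vector space $A$ with a bilinear product $\circ$ such that $(a\circ b)\circ c-a\circ(b\circ c)=(b\circ a)\circ c-b\circ(a\circ c)$ for all $a,b,c\in A$. A differential Perm-algebra $(P,d)$ is an associative (not necessarily unital) $\Bbbk$-algebra $P$ satisfying $xyz=yxz$ for all $x,y,z\in P$, together with a $\Bbbk$-linear derivation $d:P\to P$, that is, $d(xy)=d(x)y+x\,d(y)$. A Novikov dialgebra is a $\Bbbk$-vector space $N$ with two bilinear operations $\vdash,\dashv$ such that for all $x,y,z\in N$ \[ (x\dashv y)\vdash z=(x\vdash y)\vdash z,\qquad x\dashv(y\vdash z)=x\dashv(y\dashv z), \] \[ (x\dashv y)\dashv z-x\dashv(y\dashv z)=(y\vdash x)\dashv z-y\vdash(x\dashv z), \] \[ (x\vdash y)\vdash z-x\vdash(y\vdash z)=(y\vdash x)\vdash z-y\vdash(x\vdash z), \] \[ (x\dashv y)\dashv z=(x\dashv z)\dashv y,\qquad (x\vdash y)\dashv z=(x\vdash z)\vdash y. \] **Corollary.** For every left-symmetric algebra $(A,\circ)$ over $\Bbbk$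 the following are equivalent: 1. $(A,\circ)$ embeds into a differential Perm-algebra via $a\circ b=a\,d(b)$: there are a differential Perm-algebra $(P,d)$ and an injective linear map $f:A\to P$ with $f(a\circ b)=f(a)\,d(f(b))$ for all $a,b\in A$; 2. $(A,\circ)$ embeds into a Novikov dialgebra via $a\vdash b=a\circ b$: there are a Novikov dialgebra $(N,\vdash,\dashv)$ and an injective linear map $f:A\to N$ with $f(a\circ b)=f(a)\vdash f(b)$ for all $a,b\in A$. -/

import Mathlib

universe u v w

/-- A (not necessarily unital) associative ring with the left commutativity identity
`x y z = y x z`. -/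
class PermRing (P : Type*) extends NonUnitalRing P where
  left_comm' (x y z : P) : x * y * z = y * x * z

/-- A `Perm`-algebra over `k`: a `k`-vector space with a `k`-bilinear associative product
satisfying `x y z = y x z`. -/
class PermAlgebra (k : Type*) [Field k] (P : Type*) [PermRing P] : Type _ extends
  Module k P, IsScalarTower k P P, SMulCommClass k P P

/-- A derivation of a `Perm`-algebra: a `k`-linear map with `d (x y) = d x y + x d y`. -/
structure PermDerivation (k : Type*) [Field k] (P : Type*) [PermRing P] [PermAlgebra k P]
    extends P →ₗ[k] P where
  leibniz' (x y : P) : toFun (x * y) = toFun x * y + x * toFun y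

/-- A Novikov dialgebra over `k`: a vector space with bilinear operations `vdash` (`x ⊢ y`) and
`dashv` (`x ⊣ y`) satisfying the 0-identities and the two families of identities obtained from
left symmetry and right commutativity. -/
class NovikovDialgebra (k : Type*) [Field k] (N : Type*) [AddCommGroup N] [Module k N] where
  /-- The operation `x ⊢ y`. -/
  vdash : N →ₗ[k] N →ₗ[k] N
  /-- The operation `x ⊣ y`. -/
  dashv : N →ₗ[k] N →ₗ[k] N
  /-- `(x ⊣ y) ⊢ z = (x ⊢ y) ⊢ z` -/
  zero_left (x y z : N) : vdash (dashv x y) z = vdash (vdash x y) z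
  /-- `x ⊣ (y ⊢ z) = x ⊣ (y ⊣ z)` -/
  zero_right (x y z : N) : dashv x (vdash y z) = dashv x (dashv y z)
  /-- `(x ⊣ y) ⊣ z - x ⊣ (y ⊣ z) = (y ⊢ x) ⊣ z - y ⊢ (x ⊣ z)` -/
  lsymm_left (x y z : N) :
    dashv (dashv x y) z - dashv x (dashv y z) = dashv (vdash y x) z - vdash y (dashv x z)
  /-- `(x ⊢ y) ⊢ z - x ⊢ (y ⊢ z) = (y ⊢ x) ⊢ z - y ⊢ (x ⊢ z)` -/
  lsymm_right (x y z : N) :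
    vdash (vdash x y) z - vdash x (vdash y z) = vdash (vdash y x) z - vdash y (vdash x z)
  /-- `(x ⊣ y) ⊣ z = (x ⊣ z) ⊣ y` -/
  rcomm_left (x y z : N) : dashv (dashv x y) z = dashv (dashv x z) y
  /-- `(x ⊢ y) ⊣ z = (x ⊢ z) ⊢ y` -/
  rcomm_right (x y z : N) : dashv (vdash x y) z = vdash (vdash x z) y

/-- `A` embeds into a differential `Perm`-algebra `(P, d)` via `a ∘ b = a d(b)`: there is an
injective linear map `f : A → P` with `f (a ∘ b) = f a * d (f b)`. The algebra `P` is sought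
in the universe `max u v w`, for any `w`. -/
def EmbedsInDifferentialPermAlgebra (k : Type u) [Field k] (A : Type v) [LeftPreLieRing A]
    [LeftPreLieAlgebra k A] : Prop :=
  ∃ (P : Type (max u v w)) (_ : PermRing P) (_ : PermAlgebra k P) (d : PermDerivation k P)
    (f : A →ₗ[k] P),
    Function.Injective f ∧ ∀ a b : A, f (a * b) = f a * d.toLinearMap (f b)

/-- `A` embeds into a Novikov dialgebra `N` via `a ⊢ b = a ∘ b`: there is an injective linear
map `f : A → N` with `f (a ∘ b) = f a ⊢ f b`. The dialgebra `N` is sought in the universe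
`max u v w`, for any `w`. -/
def EmbedsInNovikovDialgebra (k : Type u) [Field k] (A : Type v) [LeftPreLieRing A]
    [LeftPreLieAlgebra k A] : Prop :=
  ∃ (N : Type (max u v w)) (_ : AddCommGroup N) (_ : Module k N) (_ : NovikovDialgebra k N)
    (f : A →ₗ[k] N),
    Function.Injective f ∧ ∀ a b : A, f (a * b) = NovikovDialgebra.vdash (k := k) (f a) (f b)

set_option linter.unusedSectionVars false

/-! In a differential Perm-algebra the operations `x d(y)` and `d(y) x` satisfy the dialgebra
identities, which gives one direction.

Conversely, let `N` be a Novikov dialgebra. The elements `x ⊢ y - x ⊣ y` span an ideal killed by `⊢`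
on the left and by `⊣` on the right, so the quotient acts on `N` from both sides, and the split null
extension of the quotient by `N` is a Novikov algebra (`isNovikov_extMul`). Embed it into a
commutative differential algebra `C` (`exists_embedding`). In `C × C` with `(a, b) (c, e) = (a c, a
e)`, pairing the images of `(x̄, 0)` and `(0, x)` turns `⊢` into `x d(y)`.

The embedding of a Novikov algebra `V`, in any characteristic, rests on a linear map `evalPoly m
single` from differential polynomials over `V` to `V`. It sends the variable of `x` to `x`,
satisfies `eval (x d(r)) = x ∘ eval r`, and kills all monomials of weight at least 0. Divide by the
largest differential ideal in its kernel: the relations lie in it by `mem_diffIdeal`, and a nonzero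
`x` does not since `eval x = x`.

To construct the map, the letters without derivative form a list, and a letter `y⁽ⁿ⁾` with `n > 0`
acts on functions on lists. The action is forced by `x y⁽ⁿ⁺¹⁾ r = x d(y⁽ⁿ⁾ r) - y⁽ⁿ⁾ x d(r)`, where
`x d` acts on lists as the derivation extending `z ↦ x ∘ z`. The crux is that these operators
preserve compatible functions and commute (`IsCompat.mulDeriv`, `IsCompat.mulDeriv_comm`). -/

/-- A bilinear operation is Novikov if it is left-symmetric and right-commutative. -/
structure IsNovikov {k V : Type*} [Field k] [AddCommGroup V] [Module k V]
    (m : V →ₗ[k] V →ₗ[k] V) : Prop where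
  lsymm (x y z : V) : m (m x y) z - m x (m y z) = m (m y x) z - m y (m x z)
  rcomm (x y z : V) : m (m x y) z = m (m x z) y

/-! ### Operators on functions on lists -/

namespace Novikov

variable {k V : Type*} [Field k] [AddCommGroup V] [Module k V]

/-- Prepending a fixed entry to the argument of a function on lists. -/
def shift (z : V) : Module.End k (List V → V) where
  toFun φ X := φ (z :: X)
  map_add' _ _ := rfl
  map_smul' _ _ := rfl

/-- Auxiliary recursion for `der`: the sum of the values of `φ` at the lists obtained from `X`
by multiplying one entry by `x` on the left. -/
def derAux (m : V →ₗ[k] V →ₗ[k] V) (x : V) : List V → (List V → V) → V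
  | [], _ => 0
  | z :: X, φ => φ (m x z :: X) + derAux m x X fun Y => φ (z :: Y)

/-- The derivation extending left multiplication by `x` to functions on lists. -/
def der (m : V →ₗ[k] V →ₗ[k] V) (x : V) : Module.End k (List V → V) where
  toFun φ X := derAux m x X φ
  map_add' φ ψ := by
    funext X
    induction X generalizing φ ψ with
    | nil => simp [derAux]
    | cons z X ih =>
      have := ih (fun Y => φ (z :: Y)) (fun Y => ψ (z :: Y))
      simp only [derAux, Pi.add_apply] at this ⊢
      rw [add_add_add_comm, ← this]
      rfl
  map_smul' c φ := by
    funext X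
    induction X generalizing φ with
    | nil => simp [derAux]
    | cons z X ih =>
      have := ih (fun Y => φ (z :: Y))
      simp only [derAux, Pi.smul_apply, RingHom.id_apply, smul_add] at this ⊢
      rw [← this]
      rfl

/-- The operator on functions on lists that models multiplication by the `n`-th derivative
of `y`. -/
def mulDeriv (m : V →ₗ[k] V →ₗ[k] V) (y : V) : ℕ → Module.End k (List V → V)
  | 0 => shift y
  | n + 1 =>
    -- On the empty list no letter is left to play `x`; the default 0 is what later makes words of
    -- nonnegative weight vanish.
    { toFun := fun φ X => X.casesOn 0 fun x X =>
        (mulDeriv m y n (der m x φ) - der m x (mulDeriv m y n φ)) X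
      map_add' := fun φ ψ => by
        funext X
        cases X with
        | nil => simp
        | cons x X => simp only [map_add, Pi.sub_apply, Pi.add_apply]; abel
      map_smul' := fun c φ => by
        funext X
        cases X with
        | nil => simp
        | cons x X => simp [smul_sub] }

variable {m : V →ₗ[k] V →ₗ[k] V}

@[simp] theorem shift_apply (z : V) (φ : List V → V) (X : List V) :
    shift (k := k) z φ X = φ (z :: X) := rfl

@[simp] theorem der_nil (x : V) (φ : List V → V) : der m x φ [] = 0 := rfl

theorem der_cons (x z : V) (φ : List V → V) (X : List V) :
    der m x φ (z :: X) = φ (m x z :: X) + der m x (shift (k := k) z φ) X := rfl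

theorem shift_der (x z : V) (φ : List V → V) :
    shift (k := k) z (der m x φ) =
      shift (k := k) (m x z) φ + der m x (shift (k := k) z φ) := rfl

theorem mulDeriv_zero (y : V) (φ : List V → V) : mulDeriv m y 0 φ = shift (k := k) y φ := rfl

@[simp] theorem mulDeriv_succ_nil (y : V) (n : ℕ) (φ : List V → V) :
    mulDeriv m y (n + 1) φ [] = 0 := rfl

theorem mulDeriv_succ_cons (y : V) (n : ℕ) (φ : List V → V) (x : V) (X : List V) :
    mulDeriv m y (n + 1) φ (x :: X) =
      mulDeriv m y n (der m x φ) X - der m x (mulDeriv m y n φ) X := rfl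

theorem shift_mulDeriv_succ (y : V) (n : ℕ) (φ : List V → V) (x : V) :
    shift (k := k) x (mulDeriv m y (n + 1) φ) =
      mulDeriv m y n (der m x φ) - der m x (mulDeriv m y n φ) := rfl

theorem mulDeriv_one_cons (y : V) (φ : List V → V) (x : V) (X : List V) :
    mulDeriv m y 1 φ (x :: X) = φ (m x y :: X) := by
  rw [mulDeriv_succ_cons, mulDeriv_zero, mulDeriv_zero, shift_apply, der_cons,
    add_sub_cancel_right]

/-! ### Compatible functions and their stability -/

variable (m) in
/-- Symmetric multilinear functions on lists that are compatible with the relations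
`(x ∘ y) z = x (z ∘ y)`. -/
structure IsCompat (φ : List V → V) : Prop where
  perm {X Y : List V} (h : X.Perm Y) : φ X = φ Y
  add (x y : V) (X : List V) : φ ((x + y) :: X) = φ (x :: X) + φ (y :: X)
  smul (c : k) (x : V) (X : List V) : φ ((c • x) :: X) = c • φ (x :: X)
  rel (x y z : V) (X : List V) : φ (m x y :: z :: X) = φ (x :: m z y :: X)

omit [AddCommGroup V] in
theorem perm_of_swap {φ : List V → V}
    (h : ∀ x X Y, List.Perm X Y → φ (x :: X) = φ (x :: Y))
    (hs : ∀ x y X, φ (x :: y :: X) = φ (y :: x :: X)) {X Y : List V} (p : X.Perm Y) :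
    φ X = φ Y := by
  induction p with
  | nil => rfl
  | cons x p _ => exact h x _ _ p
  | swap x y X => exact hs _ _ _
  | trans _ _ h₁ h₂ => exact h₁.trans h₂

namespace IsCompat

variable {φ ψ : List V → V}

theorem swap (h : IsCompat m φ) (x y : V) (X : List V) : φ (x :: y :: X) = φ (y :: x :: X) :=
  h.perm (.swap _ _ _)

theorem sub_head (h : IsCompat m φ) (x y : V) (X : List V) :
    φ ((x - y) :: X) = φ (x :: X) - φ (y :: X) := by
  rw [eq_sub_iff_add_eq, ← h.add, sub_add_cancel]

theorem sub (h : IsCompat m φ) (h' : IsCompat m ψ) : IsCompat m (φ - ψ) where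
  perm p := by simp [h.perm p, h'.perm p]
  add x y X := by simp only [Pi.sub_apply, h.add, h'.add]; abel
  smul c x X := by simp only [Pi.sub_apply, h.smul, h'.smul, smul_sub]
  rel x y z X := by simp only [Pi.sub_apply, h.rel, h'.rel]

theorem shift (h : IsCompat m φ) (z : V) : IsCompat m (shift (k := k) z φ) where
  perm p := h.perm (p.cons z)
  add x y X := by simp only [shift_apply, h.swap z, h.add]
  smul c x X := by simp only [shift_apply, h.swap z, h.smul]
  rel x y w X := by
    have (a b : V) : φ (z :: a :: b :: X) = φ (a :: b :: z :: X) :=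
      h.perm ((List.Perm.swap _ _ _).trans ((List.Perm.swap _ _ _).cons _))
    simp only [shift_apply, this, h.rel]

theorem shift_comm (h : IsCompat m φ) (x z : V) :
    Novikov.shift (k := k) x (Novikov.shift (k := k) z φ) =
      Novikov.shift (k := k) z (Novikov.shift (k := k) x φ) := by
  funext X
  exact h.swap _ _ _

theorem shift_add (h : IsCompat m φ) (x z : V) :
    Novikov.shift (k := k) (x + z) φ =
      Novikov.shift (k := k) x φ + Novikov.shift (k := k) z φ := by
  funext X
  exact h.add _ _ _

theorem shift_smul (h : IsCompat m φ) (c : k) (x : V) :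
    Novikov.shift (k := k) (c • x) φ = c • Novikov.shift (k := k) x φ := by
  funext X
  exact h.smul _ _ _

theorem der (hm : IsNovikov m) (h : IsCompat m φ) (x : V) : IsCompat m (der m x φ) where
  perm p := by
    induction p generalizing φ with
    | nil => rfl
    | cons z p ih => rw [der_cons, der_cons, ih (h.shift z), h.perm (p.cons _)]
    | swap a b X =>
      simp only [der_cons, shift_apply]
      rw [h.shift_comm a b, h.swap (m x b), h.swap b]
      abel
    | trans _ _ h₁ h₂ => exact (h₁ h).trans (h₂ h)
  add a b X := by
    simp only [der_cons, map_add, h.add, h.shift_add, Pi.add_apply]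
    abel
  smul c a X := by
    simp only [der_cons, map_smul, h.smul, h.shift_smul, Pi.smul_apply, smul_add]
  rel a b c X := by
    have e : Novikov.shift (k := k) c (Novikov.shift (k := k) (m a b) φ) =
        Novikov.shift (k := k) (m c b) (Novikov.shift (k := k) a φ) := by
      funext Y
      exact h.rel _ _ _ _
    -- `e` settles the letters of the tail. Where `x` hits a distinguished letter, left symmetry
    -- splits products such as `x ∘ (a ∘ b)` into terms to which the relation for `φ` applies; right
    -- commutativity enters through `e₅`.
    have e₁ := h.rel a b (m x c) X
    have e₂ := h.rel (m x a) b c X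
    have e₃ := h.rel a (m x b) c X
    have e₄ := h.rel (m a x) b c X
    have e₅ := h.rel a x (m c b) X
    have e₆ := h.sub_head (m (m x a) b) (m x (m a b)) (c :: X)
    have e₇ := h.sub_head (m (m a x) b) (m a (m x b)) (c :: X)
    have e₈ := (h.shift a).sub_head (m (m x c) b) (m x (m c b)) X
    have e₉ := (h.shift a).sub_head (m (m c x) b) (m c (m x b)) X
    rw [hm.lsymm] at e₆ e₈
    rw [e₇] at e₆
    rw [e₉] at e₈
    rw [hm.rcomm c b x] at e₅
    simp only [shift_apply] at e₈
    simp only [der_cons, shift_apply, e]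
    rw [← add_assoc, ← add_assoc]
    congr 1
    linear_combination (norm := abel) e₁ + e₂ + e₆ - e₈ + e₃ - e₄ - e₅

/-- Left symmetry says that left multiplications represent the commutator Lie algebra; this passes
to derivations, with the order reversed because they act on functions. -/
theorem der_der (hm : IsNovikov m) (h : IsCompat m φ) (x z : V) :
    Novikov.der m z (Novikov.der m x φ) - Novikov.der m x (Novikov.der m z φ) =
      Novikov.der m (m x z) φ - Novikov.der m (m z x) φ := by
  funext X
  induction X generalizing φ with
  | nil => simp
  | cons w X ih =>
    have e := ih (h.shift w)
    have e₁ := h.sub_head (m (m x z) w) (m x (m z w)) X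
    have e₂ := h.sub_head (m (m z x) w) (m z (m x w)) X
    rw [hm.lsymm, e₂] at e₁
    simp only [Pi.sub_apply] at e ⊢
    simp only [der_cons, shift_der, map_add, Pi.add_apply]
    linear_combination (norm := abel) e + e₁

theorem mulDeriv_one (hm : IsNovikov m) (h : IsCompat m φ) (y : V) :
    IsCompat m (mulDeriv m y 1 φ) where
  perm p := by
    refine perm_of_swap (fun x X Y p => ?_) (fun x z X => ?_) p
    · simp only [mulDeriv_one_cons, h.perm (p.cons _)]
    · rw [mulDeriv_one_cons, mulDeriv_one_cons, h.rel, h.swap]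
  add a b X := by simp only [mulDeriv_one_cons, map_add, LinearMap.add_apply, h.add]
  smul c a X := by simp only [mulDeriv_one_cons, map_smul, LinearMap.smul_apply, h.smul]
  rel a b c X := by
    rw [mulDeriv_one_cons, mulDeriv_one_cons, hm.rcomm, h.rel]

/-- The sum of terms `z₀ y₂ + z₁ y₁ = (z ∘ y)₁`. -/
theorem mulDeriv_one_mul (hm : IsNovikov m) (h : IsCompat m φ) (y z : V) :
    mulDeriv m (m z y) 1 φ =
      Novikov.shift (k := k) z (mulDeriv m y 2 φ) + mulDeriv m z 1 (mulDeriv m y 1 φ) := by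
  funext X
  cases X with
  | nil => simp [mulDeriv_succ_cons]
  | cons x X =>
    have e₁ := h.sub_head (m (m x z) y) (m x (m z y)) X
    have e₂ := h.sub_head (m (m z x) y) (m z (m x y)) X
    rw [hm.lsymm, e₂] at e₁
    have e : Novikov.shift (k := k) x (mulDeriv m y 1 φ) =
      Novikov.shift (k := k) (m x y) φ := by
      funext Y
      exact mulDeriv_one_cons _ _ _ _
    rw [Pi.add_apply, shift_mulDeriv_succ]
    simp only [Pi.sub_apply, mulDeriv_one_cons, der_cons, e]
    linear_combination (norm := abel) e₁

theorem der_add (h : IsCompat m φ) (x z : V) :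
    Novikov.der m (x + z) φ = Novikov.der m x φ + Novikov.der m z φ := by
  funext X
  induction X generalizing φ with
  | nil => simp
  | cons w X ih =>
    have e := ih (h.shift w)
    simp only [Pi.add_apply] at e ⊢
    simp only [der_cons, e, map_add, LinearMap.add_apply, h.add]
    abel

theorem der_smul (h : IsCompat m φ) (c : k) (x : V) :
    Novikov.der m (c • x) φ = c • Novikov.der m x φ := by
  funext X
  induction X generalizing φ with
  | nil => simp
  | cons w X ih =>
    have e := ih (h.shift w)
    simp only [Pi.smul_apply] at e ⊢
    simp only [der_cons, e, map_smul, LinearMap.smul_apply, h.smul, smul_add]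

theorem mulDeriv_one_comm_one (hm : IsNovikov m) (w y : V) (φ : List V → V) :
    mulDeriv m w 1 (mulDeriv m y 1 φ) = mulDeriv m y 1 (mulDeriv m w 1 φ) := by
  funext X
  cases X with
  | nil => simp
  | cons x X => simp only [mulDeriv_one_cons, hm.rcomm x w y]

/-- Unfolding two orders leaves, as the antisymmetric part in `x` and `z`, the commutator formula
`der_der` for `φ` and for the operator of order `n` applied to `φ`; the two cancel. -/
theorem mulDeriv_swap {n : ℕ} {y : V} (hm : IsNovikov m) (h : IsCompat m φ)
    (hn : IsCompat m (mulDeriv m y n φ)) (x z : V) (X : List V) :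
    mulDeriv m y (n + 2) φ (x :: z :: X) = mulDeriv m y (n + 2) φ (z :: x :: X) := by
  have e₁ := congrFun (hn.der_der hm x z) X
  have e₂ := congrArg (fun ψ => mulDeriv m y n ψ X) (h.der_der hm x z)
  have (x z : V) : mulDeriv m y (n + 2) φ (x :: z :: X) =
      mulDeriv m y n (Novikov.der m z (Novikov.der m x φ)) X -
        Novikov.der m z (mulDeriv m y n (Novikov.der m x φ)) X -
        mulDeriv m y n (Novikov.der m (m x z) φ) X +
        Novikov.der m (m x z) (mulDeriv m y n φ) X -
        Novikov.der m x (mulDeriv m y n (Novikov.der m z φ)) X +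
        Novikov.der m x (Novikov.der m z (mulDeriv m y n φ)) X := by
    rw [mulDeriv_succ_cons, der_cons, shift_mulDeriv_succ, mulDeriv_succ_cons,
      mulDeriv_succ_cons]
    simp only [map_sub, Pi.sub_apply]
    abel
  rw [this, this]
  simp only [map_sub, Pi.sub_apply] at e₁ e₂
  linear_combination (norm := abel) e₂ - e₁

/-- By symmetry both sides can be expanded along the second letter `z`, which lowers the order of
`y`. The failure of `z d` to commute with `w'` is then measured by `(z ∘ w)' = z w'' + z' w'`, and
left symmetry balances the rest. -/
theorem mulDeriv_comm_one_aux {n : ℕ} {y : V} (hm : IsNovikov m)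
    (hK : ∀ {φ : List V → V}, IsCompat m φ → ∀ w : V,
      mulDeriv m w 1 (mulDeriv m y (n + 1) φ) = mulDeriv m y (n + 1) (mulDeriv m w 1 φ))
    (hs : ∀ {φ : List V → V}, IsCompat m φ → ∀ x z X,
      mulDeriv m y (n + 2) φ (x :: z :: X) = mulDeriv m y (n + 2) φ (z :: x :: X))
    (hn : ∀ {φ : List V → V}, IsCompat m φ → IsCompat m (mulDeriv m y (n + 1) φ))
    (h : IsCompat m φ) (w : V) :
    mulDeriv m w 1 (mulDeriv m y (n + 2) φ) = mulDeriv m y (n + 2) (mulDeriv m w 1 φ) := by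
  have key {φ : List V → V} (h : IsCompat m φ) (w u : V) (X : List V) :
      mulDeriv m y (n + 1) φ (m u w :: X) = mulDeriv m y (n + 1) (mulDeriv m w 1 φ) (u :: X) := by
    rw [← hK h, mulDeriv_one_cons]
  have key' {φ : List V → V} (h : IsCompat m φ) (w u : V) :
      Novikov.shift (k := k) (m u w) (mulDeriv m y (n + 1) φ) =
        Novikov.shift (k := k) u (mulDeriv m y (n + 1) (mulDeriv m w 1 φ)) :=
    funext fun X => key h w u X
  funext X
  match X with
  | [] => simp
  | [x] =>
    rw [mulDeriv_one_cons, mulDeriv_succ_cons, mulDeriv_succ_cons]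
    simp
  | x :: z :: X =>
    rw [mulDeriv_one_cons, hs h, hs (h.mulDeriv_one hm w)]
    have exp (φ : List V → V) (u : V) : mulDeriv m y (n + 2) φ (z :: u :: X) =
        mulDeriv m y (n + 1) (Novikov.der m z φ) (u :: X) -
          mulDeriv m y (n + 1) φ (m z u :: X) -
          Novikov.der m z (Novikov.shift (k := k) u (mulDeriv m y (n + 1) φ)) X := by
      rw [mulDeriv_succ_cons, der_cons]
      abel
    have e₁ := congrArg (fun ψ => mulDeriv m y (n + 1) ψ (x :: X)) (h.mulDeriv_one_mul hm w z)
    have e₂ := (hn h).sub_head (m (m x z) w) (m x (m z w)) X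
    have e₃ := (hn h).sub_head (m (m z x) w) (m z (m x w)) X
    rw [hm.lsymm, e₃] at e₂
    rw [shift_mulDeriv_succ] at e₁
    simp only [map_add, map_sub, Pi.add_apply, Pi.sub_apply] at e₁
    rw [exp, exp, key (h.der hm z), key' h, ← key h w (m z x)]
    have e₄ := key h (m z w) x X
    have e₅ := key (h.mulDeriv_one hm w) z x X
    have e₆ := key h w (m x z) X
    linear_combination (norm := abel) e₂ - e₁ - e₄ + e₅ + e₆

/-- The claims need a joint induction: symmetry at order `n + 2` uses compatibility at order `n`,
commutation with `w'` uses that symmetry, and the relation at order `n + 2` uses both. -/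
theorem mulDeriv_compat_and_comm (hm : IsNovikov m) (y : V) (n : ℕ) :
    (∀ {φ : List V → V}, IsCompat m φ → IsCompat m (mulDeriv m y n φ)) ∧
    (∀ {φ : List V → V}, IsCompat m φ → IsCompat m (mulDeriv m y (n + 1) φ)) ∧
    ∀ {φ : List V → V}, IsCompat m φ → ∀ w : V,
      mulDeriv m w 1 (mulDeriv m y (n + 1) φ) = mulDeriv m y (n + 1) (mulDeriv m w 1 φ) := by
  induction n with
  | zero =>
    exact ⟨fun h => h.shift y, fun h => h.mulDeriv_one hm y,
      fun h w => mulDeriv_one_comm_one hm w y _⟩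
  | succ n ih =>
    obtain ⟨hC₀, hC, hK⟩ := ih
    have hs {φ : List V → V} (h : IsCompat m φ) (x z : V) (X : List V) :=
      h.mulDeriv_swap hm (hC₀ h) x z X
    have hK' {φ : List V → V} (h : IsCompat m φ) (w : V) :=
      h.mulDeriv_comm_one_aux hm hK hs hC w
    refine ⟨hC, fun {φ} h => ?_, hK'⟩
    have e (x : V) : IsCompat m (Novikov.shift (k := k) x (mulDeriv m y (n + 2) φ)) := by
      rw [shift_mulDeriv_succ]
      exact (hC (h.der hm x)).sub ((hC h).der hm x)
    refine ⟨fun p => perm_of_swap (fun x X Y p => (e x).perm p) (hs h) p, fun a b X => ?_,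
      fun c a X => ?_, fun a b c X => ?_⟩
    · simp only [mulDeriv_succ_cons _ (n + 1), h.der_add, (hC h).der_add, map_add, Pi.add_apply]
      abel
    · simp only [mulDeriv_succ_cons _ (n + 1), h.der_smul, (hC h).der_smul, map_smul,
        Pi.smul_apply, smul_sub]
    -- Writing `a ∘ b` as `a b'` and moving `b'` inside reduces the relation to exchanging `a` and
    -- `c`.
    · rw [← mulDeriv_one_cons b (mulDeriv m y (n + 2) φ) a, hK' h,
        hs (h.mulDeriv_one hm b), ← hK' h, mulDeriv_one_cons, hs h]

theorem mulDeriv (hm : IsNovikov m) (h : IsCompat m φ) (y : V) (n : ℕ) :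
    IsCompat m (mulDeriv m y n φ) :=
  (mulDeriv_compat_and_comm hm y n).1 h

theorem mulDeriv_comm_one (hm : IsNovikov m) (h : IsCompat m φ) (w y : V) (n : ℕ) :
    Novikov.mulDeriv m w 1 (Novikov.mulDeriv m y (n + 1) φ) =
      Novikov.mulDeriv m y (n + 1) (Novikov.mulDeriv m w 1 φ) :=
  (mulDeriv_compat_and_comm hm y n).2.2 h w

end IsCompat

/-! ### Vanishing on short lists and commutation of all operators -/

theorem der_congr {x : V} {φ ψ : List V → V} {X : List V}
    (h : ∀ Y : List V, Y.length = X.length → φ Y = ψ Y) : der m x φ X = der m x ψ X := by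
  induction X generalizing φ ψ with
  | nil => rfl
  | cons z X ih =>
    rw [der_cons, der_cons, h _ (by simp)]
    exact congrArg _ (ih fun Y hY => h (z :: Y) (by simp [hY]))

/-- `φ` vanishes on all lists of length less than `c`. -/
def VanishesBelow (c : ℕ) (φ : List V → V) : Prop :=
  ∀ X : List V, X.length < c → φ X = 0

theorem VanishesBelow.der {c : ℕ} {φ : List V → V} (h : VanishesBelow c φ) (x : V) :
    VanishesBelow c (der m x φ) := fun X hX => by
  rw [der_congr (ψ := 0) fun Y hY => h Y (hY ▸ hX), map_zero, Pi.zero_apply]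

theorem vanishesBelow_mulDeriv (y : V) (n : ℕ) (φ : List V → V) :
    VanishesBelow n (mulDeriv m y n φ) := by
  induction n generalizing φ with
  | zero => exact fun X hX => absurd hX (Nat.not_lt_zero _)
  | succ n ih =>
    intro X hX
    cases X with
    | nil => rfl
    | cons x X =>
      have hX : X.length < n := by simpa using hX
      rw [mulDeriv_succ_cons, ih _ X hX, (ih φ).der x X hX, sub_zero]

/-- A letter `y⁽ⁿ⁾` consumes `n` entries and contributes one, hence the shift of the bound by `n -
1`. -/
theorem VanishesBelow.mulDeriv {c : ℕ} {φ : List V → V} (h : VanishesBelow (c + 1) φ) (y : V)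
    (n : ℕ) : VanishesBelow (c + n) (mulDeriv m y n φ) := by
  induction n generalizing φ with
  | zero => exact fun X hX => h _ (by simpa using hX)
  | succ n ih =>
    intro X hX
    cases X with
    | nil => rfl
    | cons x X =>
      have hX : X.length < c + n := by simpa [← add_assoc] using hX
      rw [mulDeriv_succ_cons, ih (h.der x) X hX, (ih h).der x X hX, sub_zero]

namespace IsCompat

variable {φ : List V → V}

/-- Both sides model `x y⁽ⁿ⁾ X`, but on the right `x` is not available to absorb derivatives. The
length bound ensures that `X` alone suffices; on shorter lists the right side is 0 by convention. -/
theorem mulDeriv_shift (hm : IsNovikov m) (h : IsCompat m φ) (x y : V) (n : ℕ) {X : List V}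
    (hX : n ≤ X.length) :
    Novikov.mulDeriv m y n φ (x :: X) =
      Novikov.mulDeriv m y n (Novikov.shift (k := k) x φ) X := by
  induction n generalizing x φ X with
  | zero => exact h.swap _ _ _
  | succ n ih =>
    cases X with
    | nil => simp at hX
    | cons z X =>
      have hX : n ≤ X.length := by simpa using hX
      rw [(h.mulDeriv hm y _).swap, mulDeriv_succ_cons, mulDeriv_succ_cons,
        ← der_congr (φ := Novikov.shift (k := k) x (Novikov.mulDeriv m y n φ))
          fun Y hY => ih h x (hY ▸ hX), ih (h.der hm z) x hX, shift_der, map_add, der_cons,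
        Pi.add_apply, ← ih h (m z x) hX]
      abel

theorem mulDeriv_comm (hm : IsNovikov m) (h : IsCompat m φ) (y w : V) (a b : ℕ) :
    Novikov.mulDeriv m y (a + 1) (Novikov.mulDeriv m w (b + 1) φ) =
      Novikov.mulDeriv m w (b + 1) (Novikov.mulDeriv m y (a + 1) φ) := by
  induction a generalizing φ b with
  | zero => exact h.mulDeriv_comm_one hm y w b
  | succ a ih =>
    have low (y w : V) (a b : ℕ) (X : List V) (hX : X.length < a + b + 1) :
        Novikov.mulDeriv m y (a + 1) (Novikov.mulDeriv m w (b + 1) φ) X = 0 :=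
      (vanishesBelow_mulDeriv w (b + 1) φ).mulDeriv y (a + 1) X (by omega)
    funext X
    -- `mulDeriv_shift` is unavailable on short lists, but there both composites vanish.
    rcases lt_or_ge X.length (a + 1 + b + 1) with hX | hX
    · rw [low _ _ _ _ _ hX, low _ _ _ _ _ (by omega)]
    cases X with
    | nil => simp at hX
    | cons x X =>
      rw [List.length_cons] at hX
      -- Commuting `x d` past `w⁽ᵇ⁺¹⁾` costs a term with `w⁽ᵇ⁺²⁾`; the two such terms cancel by
      -- `e'`.
      have e (φ : List V → V) : Novikov.der m x (Novikov.mulDeriv m w (b + 1) φ) =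
          Novikov.mulDeriv m w (b + 1) (Novikov.der m x φ) -
            Novikov.shift (k := k) x (Novikov.mulDeriv m w (b + 2) φ) := by
        rw [shift_mulDeriv_succ, sub_sub_cancel]
      rw [mulDeriv_succ_cons, e, ih h, e, (h.mulDeriv hm y _).mulDeriv_shift hm x w _ (by omega),
        shift_mulDeriv_succ y (a + 1) φ x, map_sub, ih (h.der hm x), map_sub]
      have e' := (h.mulDeriv hm w (b + 2)).mulDeriv_shift hm x y (a + 1) (X := X) (by omega)
      rw [ih h] at e'
      simp only [Pi.sub_apply, shift_apply, e']
      abel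

end IsCompat

/-! ### Evaluation of words and differential polynomials -/

open MvPolynomial

/-- The function on lists that sends `[x]` to `x` and vanishes on lists of other lengths. -/
def single : List V → V
  | [x] => x
  | _ => 0

theorem isCompat_single : IsCompat m single where
  perm {X Y} p := by
    have := p.length_eq
    match X, Y with
    | [], [] => rfl
    | [x], [y] => rw [List.singleton_perm_singleton.mp p]
    | _ :: _ :: _, _ :: _ :: _ => rfl
    | [], _ :: _ | _ :: _, [] | [_], _ :: _ :: _ | _ :: _ :: _, [_] => simp at this
  add x y X := by
    cases X with
    | nil => rfl
    | cons => exact (add_zero 0).symm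
  smul c x X := by
    cases X with
    | nil => rfl
    | cons => exact (smul_zero c).symm
  rel _ _ _ _ := rfl

omit [Module k V] [Field k] in
theorem vanishesBelow_single : VanishesBelow 1 (single (V := V)) := fun X hX => by
  cases X with
  | nil => rfl
  | cons => simp at hX

theorem der_comp (f : V →ₗ[k] V) (x : V) (φ : List V → V) :
    der m x (f ∘ φ) = f ∘ der m x φ := by
  funext X
  induction X generalizing φ with
  | nil => simp
  | cons z X ih =>
    have := ih (shift (k := k) z φ)
    simp only [Function.comp_apply, der_cons, map_add] at this ⊢
    rw [← this]
    rfl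

theorem mulDeriv_comp (f : V →ₗ[k] V) (y : V) (n : ℕ) (φ : List V → V) :
    mulDeriv m y n (f ∘ φ) = f ∘ mulDeriv m y n φ := by
  induction n generalizing φ with
  | zero => rfl
  | succ n ih =>
    funext X
    cases X with
    | nil => simp
    | cons x X => simp [mulDeriv_succ_cons, der_comp, ih]

/-- This is the source of `eval (x d(r)) = x ∘ eval r`: all operators commute with composing by a
linear map on the outside. -/
theorem der_single (x : V) : der m x single = m x ∘ single := by
  funext X
  match X with
  | [] => simp [single]
  | [z] => simp [single, der_cons]
  | z :: z' :: X =>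
    have : der m x (shift (k := k) z' (shift (k := k) z single)) X = 0 := by
      rw [show shift (k := k) z' (shift (k := k) z single) = 0 from rfl, map_zero]
      rfl
    simp [single, der_cons, this]

/-- The entries of a word that carry no derivative. -/
def zeros : List (V × ℕ) → List V
  | [] => []
  | (y, 0) :: l => y :: zeros l
  | (_, _ + 1) :: l => zeros l

variable (m) in
/-- The composite of the operators attached to the entries of a word that carry a derivative. -/
def posOps : List (V × ℕ) → Module.End k (List V → V)
  | [] => 1
  | (_, 0) :: l => posOps l
  | (y, n + 1) :: l => mulDeriv m y (n + 1) * posOps l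

variable (m) in
/-- The value of a differential word, with respect to a function on lists. -/
def evalWord (φ : List V → V) (l : List (V × ℕ)) : V := posOps m l φ (zeros l)

theorem IsCompat.posOps (hm : IsNovikov m) {φ : List V → V} (h : IsCompat m φ)
    (l : List (V × ℕ)) : IsCompat m (posOps m l φ) := by
  induction l with
  | nil => exact h
  | cons i l ih =>
    obtain ⟨y, _ | n⟩ := i
    · exact ih
    · exact ih.mulDeriv hm y (n + 1)

theorem posOps_mulDeriv (hm : IsNovikov m) {φ : List V → V} (h : IsCompat m φ)
    (l : List (V × ℕ)) (y : V) (n : ℕ) :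
    posOps m l (mulDeriv m y (n + 1) φ) = mulDeriv m y (n + 1) (posOps m l φ) := by
  induction l with
  | nil => rfl
  | cons i l ih =>
    obtain ⟨z, _ | a⟩ := i
    · exact ih
    · simp only [Novikov.posOps, Module.End.mul_apply, ih]
      exact (h.posOps hm l).mulDeriv_comm hm _ _ _ _

theorem posOps_comp (f : V →ₗ[k] V) (l : List (V × ℕ)) (φ : List V → V) :
    posOps m l (f ∘ φ) = f ∘ posOps m l φ := by
  induction l with
  | nil => rfl
  | cons i l ih =>
    obtain ⟨z, _ | a⟩ := i
    · exact ih
    · simp only [Novikov.posOps, Module.End.mul_apply, ih, mulDeriv_comp]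

theorem zeros_perm {l l' : List (V × ℕ)} (p : l.Perm l') : (zeros l).Perm (zeros l') := by
  induction p with
  | nil => rfl
  | cons i _ ih =>
    obtain ⟨y, _ | n⟩ := i
    · exact ih.cons _
    · exact ih
  | swap i j l =>
    obtain ⟨y, _ | n⟩ := i <;> obtain ⟨z, _ | n⟩ := j
    · exact .swap _ _ _
    all_goals rfl
  | trans _ _ h₁ h₂ => exact h₁.trans h₂

theorem posOps_perm (hm : IsNovikov m) {φ : List V → V} (h : IsCompat m φ)
    {l l' : List (V × ℕ)} (p : l.Perm l') : posOps m l φ = posOps m l' φ := by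
  induction p with
  | nil => rfl
  | cons i _ ih =>
    obtain ⟨y, _ | n⟩ := i
    · exact ih
    · simp only [posOps, Module.End.mul_apply, ih]
  | swap i j l =>
    obtain ⟨y, _ | n⟩ := i <;> obtain ⟨z, _ | n⟩ := j
    · rfl
    · rfl
    · rfl
    · exact (h.posOps hm l).mulDeriv_comm hm _ _ _ _
  | trans _ _ h₁ h₂ => exact h₁.trans h₂

theorem evalWord_perm (hm : IsNovikov m) {φ : List V → V} (h : IsCompat m φ)
    {l l' : List (V × ℕ)} (p : l.Perm l') : evalWord m φ l = evalWord m φ l' := by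
  rw [evalWord, evalWord, posOps_perm hm h p, (h.posOps hm l').perm (zeros_perm p)]

/-- `mulDeriv_shift` covers long lists. On short ones the right side always vanishes, and the bound
2 on `φ` makes the left side vanish too. -/
theorem shift_posOps (hm : IsNovikov m) {φ : List V → V} (h : IsCompat m φ)
    (hφ : VanishesBelow 2 φ) (x : V) (l : List (V × ℕ)) :
    shift (k := k) x (posOps m l φ) = posOps m l (shift (k := k) x φ) := by
  have hv (l : List (V × ℕ)) : VanishesBelow 2 (posOps m l φ) := by
    induction l with
    | nil => exact hφ
    | cons i l ih =>
      obtain ⟨y, _ | n⟩ := i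
      · exact ih
      · exact fun X hX => ih.mulDeriv y (n + 1) X (by omega)
  induction l with
  | nil => rfl
  | cons i l ih =>
    obtain ⟨y, _ | n⟩ := i
    · exact ih
    · simp only [posOps, Module.End.mul_apply, ← ih]
      funext X
      rcases lt_or_ge X.length (n + 1) with hX | hX
      · rw [vanishesBelow_mulDeriv y (n + 1) _ X hX]
        exact (hv l).mulDeriv y (n + 1) (x :: X) (by simp; omega)
      · exact (h.posOps hm l).mulDeriv_shift hm x y (n + 1) hX

/-- The weight of a word: the `n`-th derivative of an element has weight `n - 1`. -/
def weight (l : List (V × ℕ)) : ℤ := (l.map fun i => (i.2 : ℤ) - 1).sum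

/-- The bound `c` counts the derivatives in excess of one per differentiated letter, so at
nonnegative weight the list of remaining letters is too short. -/
theorem exists_vanishesBelow_posOps (l : List (V × ℕ)) :
    ∃ c : ℕ, (c : ℤ) = weight l + (zeros l).length ∧
      VanishesBelow (c + 1) (posOps m l single) := by
  induction l with
  | nil => exact ⟨0, by simp [weight, zeros], vanishesBelow_single⟩
  | cons i l ih =>
    obtain ⟨c, hc, h⟩ := ih
    obtain ⟨y, _ | n⟩ := i
    · exact ⟨c, by simp [weight, zeros] at hc ⊢; omega, h⟩
    · exact ⟨c + n, by simp [weight, zeros] at hc ⊢; omega, h.mulDeriv y (n + 1)⟩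

theorem evalWord_single_eq_zero {l : List (V × ℕ)} (hl : 0 ≤ weight l) :
    evalWord m single l = 0 := by
  obtain ⟨c, hc, h⟩ := exists_vanishesBelow_posOps (m := m) l
  exact h _ (by omega)

variable (m) in
/-- The linear extension of `evalWord` to differential polynomials. -/
noncomputable def evalPoly (φ : List V → V) : MvPolynomial (V × ℕ) k →ₗ[k] V :=
  (basisMonomials (V × ℕ) k).constr k fun s => evalWord m φ (Finsupp.toMultiset s).toList

variable (k) in
/-- The monomial of a word. -/
noncomputable def word (l : List (V × ℕ)) : MvPolynomial (V × ℕ) k := (l.map X).prod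

@[simp] theorem word_nil : word k ([] : List (V × ℕ)) = 1 := rfl

@[simp] theorem word_cons (i : V × ℕ) (l : List (V × ℕ)) : word k (i :: l) = X i * word k l := by
  simp [word]

@[simp] theorem word_append (l l' : List (V × ℕ)) : word k (l ++ l') = word k l * word k l' := by
  simp [word]

theorem word_toList (s : V × ℕ →₀ ℕ) :
    word k (Finsupp.toMultiset s).toList = basisMonomials (V × ℕ) k s := by
  classical
  have (l : List (V × ℕ)) : word k l = monomial (Multiset.toFinsupp (l : Multiset (V × ℕ))) 1 := by
    induction l with
    | nil => simp
    | cons i l ih =>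
      rw [word_cons, ih, ← Multiset.cons_coe, ← Multiset.singleton_add, map_add,
        Multiset.toFinsupp_singleton, X, monomial_mul, one_mul]
  rw [this, Multiset.coe_toList, Finsupp.toMultiset_toFinsupp, coe_basisMonomials]

theorem evalPoly_word (hm : IsNovikov m) {φ : List V → V} (h : IsCompat m φ)
    (l : List (V × ℕ)) : evalPoly m φ (word k l) = evalWord m φ l := by
  classical
  have : word k l = basisMonomials (V × ℕ) k (Multiset.toFinsupp (l : Multiset (V × ℕ))) := by
    rw [← word_toList, Multiset.toFinsupp_toMultiset, word, word]
    refine List.Perm.prod_eq (List.Perm.map _ ?_)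
    rw [← Multiset.coe_eq_coe, Multiset.coe_toList]
  rw [this, evalPoly, Module.Basis.constr_basis, Multiset.toFinsupp_toMultiset]
  refine evalWord_perm hm h ?_
  rw [← Multiset.coe_eq_coe, Multiset.coe_toList]

/-- The word of a list of elements without derivatives. -/
abbrev zeroWord (Z : List V) : List (V × ℕ) := Z.map fun z => (z, 0)

/-- The word obtained by raising the order of all derivatives by one. -/
abbrev posWord (a : List (V × ℕ)) : List (V × ℕ) := a.map fun i => (i.1, i.2 + 1)

@[elab_as_elim]
theorem word_induction {p : MvPolynomial (V × ℕ) k → Prop}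
    (word : ∀ Z a, p (word k (zeroWord Z) * word k (posWord a)))
    (add : ∀ r s, p r → p s → p (r + s)) (smul : ∀ (c : k) r, p r → p (c • r))
    (r : MvPolynomial (V × ℕ) k) : p r := by
  have key (l : List (V × ℕ)) :
      ∃ Z a, Novikov.word k l = Novikov.word k (zeroWord Z) * Novikov.word k (posWord a) := by
    induction l with
    | nil => exact ⟨[], [], by simp⟩
    | cons i l ih =>
      obtain ⟨Z, a, e⟩ := ih
      obtain ⟨y, _ | n⟩ := i
      · exact ⟨y :: Z, a, by simp [e, mul_assoc]⟩
      · exact ⟨Z, (y, n) :: a, by simp [e, mul_left_comm]⟩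
  refine MvPolynomial.induction_on' r (fun s c => ?_) add
  obtain ⟨Z, a, e⟩ := key (Finsupp.toMultiset s).toList
  have := smul c _ (word Z a)
  rwa [← e, word_toList, coe_basisMonomials, smul_monomial, smul_eq_mul, mul_one] at this

theorem posOps_append (l l' : List (V × ℕ)) :
    posOps m (l ++ l') = posOps m l * posOps m l' := by
  induction l with
  | nil => rfl
  | cons i l ih =>
    obtain ⟨y, _ | n⟩ := i
    · exact ih
    · rw [List.cons_append, posOps, posOps, ih, mul_assoc]

theorem zeros_append (l l' : List (V × ℕ)) : zeros (l ++ l') = zeros l ++ zeros l' := by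
  induction l with
  | nil => rfl
  | cons i l ih =>
    obtain ⟨y, _ | n⟩ := i
    · exact congrArg _ ih
    · exact ih

@[simp] theorem zeros_zeroWord (Z : List V) : zeros (zeroWord Z) = Z := by
  induction Z with
  | nil => rfl
  | cons z Z ih => exact congrArg _ ih

@[simp] theorem zeros_posWord (a : List (V × ℕ)) : zeros (posWord a) = [] := by
  induction a with
  | nil => rfl
  | cons i a ih => exact ih

@[simp] theorem posOps_zeroWord (Z : List V) : posOps m (zeroWord Z) = 1 := by
  induction Z with
  | nil => rfl
  | cons z Z ih => exact ih

theorem evalPoly_zeroWord_mul_posWord (hm : IsNovikov m) {φ : List V → V} (h : IsCompat m φ)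
    (Z : List V) (a : List (V × ℕ)) :
    evalPoly m φ (word k (zeroWord Z) * word k (posWord a)) = posOps m (posWord a) φ Z := by
  rw [← word_append, evalPoly_word hm h, evalWord, posOps_append, zeros_append]
  simp

theorem evalPoly_X_succ_mul (hm : IsNovikov m) {φ : List V → V} (h : IsCompat m φ) (y : V)
    (n : ℕ) (r : MvPolynomial (V × ℕ) k) :
    evalPoly m φ (X (y, n + 1) * r) = evalPoly m (mulDeriv m y (n + 1) φ) r := by
  induction r using word_induction with
  | word Z a =>
    have : X (y, n + 1) * (word k (zeroWord Z) * word k (posWord a)) =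
        word k (zeroWord Z) * word k (posWord ((y, n) :: a)) := by
      simp [mul_left_comm]
    rw [this, evalPoly_zeroWord_mul_posWord hm h,
      evalPoly_zeroWord_mul_posWord hm (h.mulDeriv hm _ _), posOps_mulDeriv hm h]
    rfl
  | add r s hr hs => rw [mul_add, map_add, map_add, hr, hs]
  | smul c r hr => rw [mul_smul_comm, map_smul, map_smul, hr]

/-! ### Compatibility of evaluation with the derivation -/

variable (k V) in
/-- The derivation of the ring of differential polynomials. -/
noncomputable def polyDer :
    Derivation k (MvPolynomial (V × ℕ) k) (MvPolynomial (V × ℕ) k) :=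
  mkDerivation k fun i => X (i.1, i.2 + 1)

@[simp] theorem polyDer_X (i : V × ℕ) : polyDer k V (X i) = X (i.1, i.2 + 1) :=
  mkDerivation_X _ _ _

/-- Each letter contributes the commutator of its operator with `x d`, by the very recursion
defining `mulDeriv`; Leibniz adds these up to the commutator with the whole composite. -/
theorem evalPoly_mul_polyDer_posWord (hm : IsNovikov m) {φ : List V → V} (h : IsCompat m φ)
    (x : V) (Z : List V) (a : List (V × ℕ)) :
    evalPoly m φ (X (x, 0) * word k (zeroWord Z) * polyDer k V (word k (posWord a))) =
      posOps m (posWord a) (der m x φ) Z - der m x (posOps m (posWord a) φ) Z := by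
  induction a generalizing φ with
  | nil => simp [posOps]
  | cons i a ih =>
    obtain ⟨y, n⟩ := i
    have e : X (x, 0) * word k (zeroWord Z) * polyDer k V (word k (posWord ((y, n) :: a))) =
        word k (zeroWord (x :: Z)) * word k (posWord ((y, n + 1) :: a)) +
        X (y, n + 1) *
          (X (x, 0) * word k (zeroWord Z) * polyDer k V (word k (posWord a))) := by
      simp only [List.map_cons, word_cons, Derivation.leibniz, polyDer_X, smul_eq_mul]
      ring
    have e₁ : posOps m (posWord ((y, n + 1) :: a)) φ (x :: Z) =
        posOps m (posWord a) (mulDeriv m y (n + 1) (der m x φ)) Z -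
          posOps m (posWord a) (der m x (mulDeriv m y (n + 1) φ)) Z := by
      rw [← Pi.sub_apply, ← map_sub, ← shift_mulDeriv_succ,
        ← shift_posOps hm (h.mulDeriv hm _ _)
          fun X hX => vanishesBelow_mulDeriv y (n + 2) φ X (by omega),
        posOps_mulDeriv hm h]
      rfl
    rw [e, map_add, evalPoly_X_succ_mul hm h, ih (h.mulDeriv hm _ _),
      evalPoly_zeroWord_mul_posWord hm h, e₁, posOps_mulDeriv hm h,
      posOps_mulDeriv hm (h.der hm x)]
    simp only [List.map_cons, posOps, Module.End.mul_apply]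
    abel

/-- Each term `x z'` evaluates as `x ∘ z`, so differentiating undifferentiated letters is `der`. `Z`
collects the letters already passed in the induction. -/
theorem evalPoly_mul_polyDer_zeroWord (hm : IsNovikov m) {φ : List V → V} (h : IsCompat m φ)
    (x : V) (Z W : List V) (a : List (V × ℕ)) :
    evalPoly m φ (X (x, 0) * word k (zeroWord Z) * polyDer k V (word k (zeroWord W)) *
      word k (posWord a)) =
      der m x (fun Y => posOps m (posWord a) φ (Z ++ Y)) W := by
  induction W generalizing Z with
  | nil => simp
  | cons z W ih =>
    have e : X (x, 0) * word k (zeroWord Z) * polyDer k V (word k (zeroWord (z :: W))) *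
        word k (posWord a) =
        word k (zeroWord (x :: (Z ++ W))) * word k (posWord ((z, 0) :: a)) +
        X (x, 0) * word k (zeroWord (z :: Z)) * polyDer k V (word k (zeroWord W)) *
          word k (posWord a) := by
      simp only [List.map_cons, word_cons, Derivation.leibniz, polyDer_X, smul_eq_mul,
        List.map_append, word_append]
      ring
    have h' := h.posOps hm (posWord a)
    rw [e, map_add, ih, evalPoly_zeroWord_mul_posWord hm h, der_cons]
    congr 1
    · simp only [List.map_cons, posOps, Module.End.mul_apply, zero_add]
      rw [mulDeriv_one_cons]
      exact h'.perm List.perm_middle.symm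
    · refine congrArg (fun ψ => der m x ψ W) (funext fun Y => ?_)
      exact h'.perm List.perm_middle.symm

/-- Adding the contributions of both kinds of letters cancels the outer `der`, leaving `der m x
single` inside, where `der_single` applies. -/
theorem evalPoly_single_X_mul_polyDer (hm : IsNovikov m) (x : V)
    (r : MvPolynomial (V × ℕ) k) :
    evalPoly m single (X (x, 0) * polyDer k V r) = m x (evalPoly m single r) := by
  induction r using word_induction with
  | word Z a =>
    have e : X (x, 0) * polyDer k V (word k (zeroWord Z) * word k (posWord a)) =
        X (x, 0) * word k (zeroWord Z) * polyDer k V (word k (posWord a)) +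
        X (x, 0) * word k (zeroWord []) * polyDer k V (word k (zeroWord Z)) *
          word k (posWord a) := by
      simp only [Derivation.leibniz, smul_eq_mul, List.map_nil, word_nil]
      ring
    rw [e, map_add, evalPoly_mul_polyDer_posWord hm isCompat_single,
      evalPoly_mul_polyDer_zeroWord hm isCompat_single,
      evalPoly_zeroWord_mul_posWord hm isCompat_single, der_single, posOps_comp]
    simp
  | add r s hr hs => simp only [mul_add, map_add, hr, hs]
  | smul c r hr => rw [Derivation.map_smul, mul_smul_comm, map_smul, map_smul, hr, map_smul]

/-! ### The weight filtration and the differential ideal -/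

variable (k V) in
/-- The span of the monomials of weight at least `j`. -/
noncomputable def weightGE (j : ℤ) : Submodule k (MvPolynomial (V × ℕ) k) :=
  Submodule.span k {r | ∃ l : List (V × ℕ), j ≤ weight l ∧ word k l = r}

theorem weightGE_anti {i j : ℤ} (h : i ≤ j) : weightGE k V j ≤ weightGE k V i :=
  Submodule.span_mono fun _ ⟨l, hl, e⟩ => ⟨l, h.trans hl, e⟩

theorem word_mem_weightGE {j : ℤ} {l : List (V × ℕ)} (h : j ≤ weight l) :
    word k l ∈ weightGE k V j := Submodule.subset_span ⟨l, h, rfl⟩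

theorem weight_append (l l' : List (V × ℕ)) : weight (l ++ l') = weight l + weight l' := by
  simp [weight]

theorem word_mul_mem_weightGE {i j : ℤ} {l : List (V × ℕ)} (h : i ≤ weight l)
    {r : MvPolynomial (V × ℕ) k} (hr : r ∈ weightGE k V j) :
    word k l * r ∈ weightGE k V (i + j) := by
  induction hr using Submodule.span_induction with
  | mem r hr =>
    obtain ⟨l', h', rfl⟩ := hr
    rw [← word_append]
    exact word_mem_weightGE (by rw [weight_append]; omega)
  | zero => simp
  | add r s _ _ hr hs => rw [mul_add]; exact add_mem hr hs
  | smul c r _ hr => rw [mul_smul_comm]; exact Submodule.smul_mem _ _ hr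

theorem polyDer_mem_weightGE {j : ℤ} {r : MvPolynomial (V × ℕ) k} (hr : r ∈ weightGE k V j) :
    polyDer k V r ∈ weightGE k V (j + 1) := by
  induction hr using Submodule.span_induction with
  | mem r hr =>
    obtain ⟨l, h, rfl⟩ := hr
    induction l generalizing j with
    | nil => simp
    | cons i l ih =>
      have hw (i : V × ℕ) (l : List (V × ℕ)) : weight (i :: l) = i.2 - 1 + weight l := by
        simp [weight]
      rw [hw] at h
      rw [word_cons, Derivation.leibniz, polyDer_X, smul_eq_mul, smul_eq_mul, mul_comm (word k l),
        ← word_cons]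
      refine add_mem ?_ (word_mem_weightGE (by rw [hw]; push_cast; omega))
      have := word_mul_mem_weightGE (l := [i]) le_rfl (ih (j := weight l) le_rfl)
      rw [word_cons, word_nil, mul_one] at this
      exact weightGE_anti (by simp only [weight, List.map_cons, List.map_nil, List.sum_cons,
        List.sum_nil] at h ⊢; omega) this
  | zero => simp
  | add r s _ _ hr hs => rw [map_add]; exact add_mem hr hs
  | smul c r _ hr => rw [Derivation.map_smul]; exact Submodule.smul_mem _ _ hr

theorem evalPoly_single_eq_zero (hm : IsNovikov m) {r : MvPolynomial (V × ℕ) k}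
    (hr : r ∈ weightGE k V 0) : evalPoly m single r = 0 := by
  induction hr using Submodule.span_induction with
  | mem r hr =>
    obtain ⟨l, h, rfl⟩ := hr
    rw [evalPoly_word hm isCompat_single, evalWord_single_eq_zero h]
  | zero => simp
  | add r s _ _ hr hs => rw [map_add, hr, hs, add_zero]
  | smul c r _ hr => rw [map_smul, hr, smul_zero]

variable (m) in
/-- The largest ideal on which `evalPoly m single` vanishes. -/
noncomputable def kerIdeal : Ideal (MvPolynomial (V × ℕ) k) where
  carrier := {r | ∀ s, evalPoly m single (s * r) = 0}
  zero_mem' s := by simp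
  add_mem' hr hr' s := by rw [mul_add, map_add, hr, hr', add_zero]
  smul_mem' c r hr s := by rw [smul_eq_mul, ← mul_assoc, hr]

variable (m) in
/-- The largest differential ideal on which `evalPoly m single` vanishes. -/
noncomputable def diffIdeal : Ideal (MvPolynomial (V × ℕ) k) where
  carrier := {r | ∀ n, (polyDer k V)^[n] r ∈ kerIdeal m}
  zero_mem' n := by rw [iterate_map_zero]; exact zero_mem _
  add_mem' hr hr' n := by rw [iterate_map_add]; exact add_mem (hr n) (hr' n)
  smul_mem' c r hr n := by
    simp only [Set.mem_ofPred_eq] at hr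
    induction n generalizing c r with
    | zero => exact Ideal.mul_mem_left _ _ (hr 0)
    | succ n ih =>
      rw [Function.iterate_succ_apply, smul_eq_mul, Derivation.leibniz, iterate_map_add]
      refine add_mem (ih c _ fun j => hr (j + 1)) ?_
      rw [smul_eq_mul, mul_comm, ← smul_eq_mul]
      exact ih _ r hr

theorem polyDer_mem_diffIdeal {r : MvPolynomial (V × ℕ) k} (hr : r ∈ diffIdeal m) :
    polyDer k V r ∈ diffIdeal m := fun n => hr (n + 1)

/-- Derivatives need no separate check: a multiplier containing some `x` allows integration by
parts, and one without such a letter gives nonnegative weight. -/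
theorem mem_diffIdeal (hm : IsNovikov m) {r : MvPolynomial (V × ℕ) k} (hr : r ∈ kerIdeal m)
    (hw : r ∈ weightGE k V (-1)) : r ∈ diffIdeal m := by
  have hw' (n : ℕ) : (polyDer k V)^[n] r ∈ weightGE k V (n - 1) := by
    induction n with
    | zero => simpa using hw
    | succ n ih =>
      rw [Function.iterate_succ_apply']
      convert polyDer_mem_weightGE ih using 1
      push_cast
      ring_nf
  intro n
  induction n with
  | zero => exact hr
  | succ n ih =>
    intro s
    induction s using word_induction with
    | word Z a =>
      cases Z with
      | nil =>
        have h : (0 : ℤ) ≤ weight (posWord a) := by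
          refine List.sum_nonneg fun j hj => ?_
          simp only [List.map_map, List.mem_map] at hj
          obtain ⟨i, -, rfl⟩ := hj
          simp
        have := word_mul_mem_weightGE h (hw' (n + 1))
        rw [zeroWord, List.map_nil, word_nil, one_mul]
        exact evalPoly_single_eq_zero hm (weightGE_anti (by push_cast; omega) this)
      | cons x Z =>
        set t := word k (zeroWord Z) * word k (posWord a) with ht
        -- Integration by parts: both terms on the right involve multiples of the `n`-th derivative,
        -- which evaluate to 0 by induction.
        have e : word k (zeroWord (x :: Z)) * word k (posWord a) * (polyDer k V)^[n + 1] r =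
            X (x, 0) * polyDer k V (t * (polyDer k V)^[n] r) -
              X (x, 0) * polyDer k V t * (polyDer k V)^[n] r := by
          rw [Function.iterate_succ_apply', Derivation.leibniz, zeroWord, List.map_cons, word_cons,
            smul_eq_mul, smul_eq_mul, mul_assoc (X _), ← zeroWord, ← ht]
          ring
        rw [e, map_sub, evalPoly_single_X_mul_polyDer hm, ih, ih, map_zero, sub_zero]
    | add s t hs ht => rw [add_mul, map_add, hs, ht, add_zero]
    | smul c s hs => rw [smul_mul_assoc, map_smul, hs, smul_zero]

theorem evalPoly_mul_X_zero (hm : IsNovikov m) {φ : List V → V} (h : IsCompat m φ) (x : V)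
    (Z : List V) (a : List (V × ℕ)) :
    evalPoly m φ (word k (zeroWord Z) * word k (posWord a) * X (x, 0)) =
      posOps m (posWord a) φ (x :: Z) := by
  rw [← evalPoly_zeroWord_mul_posWord hm h, mul_comm, ← mul_assoc, ← word_cons]
  rfl

theorem X_mem_weightGE (x : V) : (X (x, 0) : MvPolynomial (V × ℕ) k) ∈ weightGE k V (-1) := by
  simpa using word_mem_weightGE (k := k) (l := [(x, 0)]) (j := -1) (by simp [weight])

theorem X_add_mem (hm : IsNovikov m) (x y : V) :
    (X (x + y, 0) - (X (x, 0) + X (y, 0)) : MvPolynomial (V × ℕ) k) ∈ diffIdeal m := by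
  refine mem_diffIdeal hm (fun s => ?_)
    (sub_mem (X_mem_weightGE _) (add_mem (X_mem_weightGE _) (X_mem_weightGE _)))
  induction s using word_induction with
  | word Z a =>
    rw [mul_sub, mul_add, map_sub, map_add]
    simp only [evalPoly_mul_X_zero hm isCompat_single]
    rw [(isCompat_single.posOps hm _).add, sub_self]
  | add s t hs ht => rw [add_mul, map_add, hs, ht, add_zero]
  | smul c s hs => rw [smul_mul_assoc, map_smul, hs, smul_zero]

theorem X_smul_mem (hm : IsNovikov m) (c : k) (x : V) :
    (X (c • x, 0) - c • X (x, 0) : MvPolynomial (V × ℕ) k) ∈ diffIdeal m := by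
  refine mem_diffIdeal hm (fun s => ?_)
    (sub_mem (X_mem_weightGE _) (Submodule.smul_mem _ _ (X_mem_weightGE _)))
  induction s using word_induction with
  | word Z a =>
    rw [mul_sub, mul_smul_comm, map_sub, map_smul]
    simp only [evalPoly_mul_X_zero hm isCompat_single]
    rw [(isCompat_single.posOps hm _).smul, sub_self]
  | add s t hs ht => rw [add_mul, map_add, hs, ht, add_zero]
  | smul c s hs => rw [smul_mul_assoc, map_smul, hs, smul_zero]

theorem X_mul_mem (hm : IsNovikov m) (x y : V) :
    (X (m x y, 0) - X (x, 0) * X (y, 1) : MvPolynomial (V × ℕ) k) ∈ diffIdeal m := by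
  refine mem_diffIdeal hm (fun s => ?_) (sub_mem (X_mem_weightGE _) ?_)
  · induction s using word_induction with
    | word Z a =>
      have : word k (zeroWord Z) * word k (posWord a) * (X (x, 0) * X (y, 1)) =
          word k (zeroWord Z) * word k (posWord ((y, 0) :: a)) * X (x, 0) := by
        simp only [List.map_cons, word_cons]
        ring
      rw [mul_sub, map_sub, this, evalPoly_mul_X_zero hm isCompat_single,
        evalPoly_mul_X_zero hm isCompat_single]
      simp only [List.map_cons, posOps, Module.End.mul_apply, zero_add]
      rw [mulDeriv_one_cons, sub_self]
    | add s t hs ht => rw [add_mul, map_add, hs, ht, add_zero]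
    | smul c s hs => rw [smul_mul_assoc, map_smul, hs, smul_zero]
  · simpa using word_mem_weightGE (k := k) (l := [(x, 0), (y, 1)]) (j := -1) (by simp [weight])

/-- Every Novikov algebra embeds into a commutative differential algebra. -/
theorem exists_embedding {k : Type u} {V : Type (max u v)} [Field k] [AddCommGroup V] [Module k V]
    {m : V →ₗ[k] V →ₗ[k] V} (hm : IsNovikov m) :
    ∃ (C : Type (max u v)) (_ : CommRing C) (_ : Algebra k C) (d : Derivation k C C)
      (f : V →ₗ[k] C), Function.Injective f ∧ ∀ x y, f (m x y) = f x * d (f y) := by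
  let q := Ideal.Quotient.mkₐ k (diffIdeal m)
  have hq : Function.Surjective q := Ideal.Quotient.mkₐ_surjective _ _
  have hd (r : MvPolynomial (V × ℕ) k) (hr : q r = 0) : q (polyDer k V r) = 0 := by
    rw [Ideal.Quotient.mkₐ_eq_mk, Ideal.Quotient.eq_zero_iff_mem] at hr ⊢
    exact polyDer_mem_diffIdeal hr
  refine ⟨MvPolynomial (V × ℕ) k ⧸ diffIdeal m, inferInstance, inferInstance,
    Derivation.liftOfSurjective hq hd,
    { toFun := fun x => q (X (x, 0))
      map_add' := fun x y => ?_
      map_smul' := fun c x => ?_ }, ?_, fun x y => ?_⟩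
  · rw [← map_add]
    exact Ideal.Quotient.eq.mpr (X_add_mem hm x y)
  · rw [RingHom.id_apply, ← map_smul]
    exact Ideal.Quotient.eq.mpr (X_smul_mem hm c x)
  · rw [injective_iff_map_eq_zero]
    intro x hx
    have hx : X (x, 0) ∈ diffIdeal m := Ideal.Quotient.eq_zero_iff_mem.mp hx
    have := hx 0 1
    have e := evalPoly_mul_X_zero (k := k) (m := m) hm isCompat_single x [] []
    simp only [List.map_nil, word_nil, mul_one] at e
    rw [Function.iterate_zero_apply, e] at this
    exact this
  · change q _ = q _ * Derivation.liftOfSurjective hq hd (q _)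
    rw [Derivation.liftOfSurjective_apply, polyDer_X, ← map_mul]
    exact Ideal.Quotient.eq.mpr (X_mul_mem hm x y)

end Novikov

/-! ### The split null extension of a Novikov dialgebra -/

namespace NovikovDialgebra

variable (k : Type*) [Field k] (N : Type*) [AddCommGroup N] [Module k N] [NovikovDialgebra k N]

/-- The span of the elements `x ⊢ y - x ⊣ y`. -/
def defect : Submodule k N :=
  Submodule.span k {z | ∃ x y : N, vdash (k := k) x y - dashv (k := k) x y = z}

variable {k N}

theorem sub_mem_defect (x y : N) :
    vdash (k := k) x y - dashv (k := k) x y ∈ defect k N :=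
  Submodule.subset_span ⟨x, y, rfl⟩

theorem vdash_eq_zero {x : N} (hx : x ∈ defect k N) : vdash (k := k) x = 0 := by
  have : defect k N ≤ LinearMap.ker (vdash (k := k) (N := N)) := by
    refine Submodule.span_le.mpr ?_
    rintro _ ⟨x, y, rfl⟩
    refine LinearMap.ext fun z => ?_
    rw [map_sub, LinearMap.sub_apply, zero_left, sub_self, LinearMap.zero_apply]
  exact this hx

theorem dashv_eq_zero (x : N) {y : N} (hy : y ∈ defect k N) : dashv (k := k) x y = 0 := by
  have : defect k N ≤ LinearMap.ker (dashv (k := k) x) := by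
    refine Submodule.span_le.mpr ?_
    rintro _ ⟨y, z, rfl⟩
    exact (map_sub _ _ _).trans (sub_eq_zero.mpr (zero_right _ _ _))
  exact this hy

theorem vdash_mem (x : N) {y : N} (hy : y ∈ defect k N) :
    vdash (k := k) x y ∈ defect k N := by
  simpa [dashv_eq_zero x hy] using sub_mem_defect (k := k) x y

variable (k N)

/-- The left action of the quotient by `defect` induced by `⊢`. -/
def leftAct : (N ⧸ defect k N) →ₗ[k] N →ₗ[k] N :=
  (defect k N).liftQ vdash fun _ hx => vdash_eq_zero hx

/-- The right action of the quotient by `defect` induced by `⊣`. -/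
def rightAct : N →ₗ[k] (N ⧸ defect k N) →ₗ[k] N :=
  ((defect k N).liftQ dashv.flip fun _ hy => LinearMap.ext fun x => dashv_eq_zero x hy).flip

/-- The product of the quotient by `defect`. -/
def quotMul : (N ⧸ defect k N) →ₗ[k] (N ⧸ defect k N) →ₗ[k] (N ⧸ defect k N) :=
  ((defect k N).liftQ ((leftAct k N).compr₂ (defect k N).mkQ).flip fun y hy => by
    refine LinearMap.ext fun x => ?_
    obtain ⟨x, rfl⟩ := (defect k N).mkQ_surjective x
    exact (Submodule.Quotient.mk_eq_zero _).mpr (vdash_mem x hy)).flip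

/-- The product of the split null extension of the quotient by `defect`. -/
def extMul : ((N ⧸ defect k N) × N) →ₗ[k] ((N ⧸ defect k N) × N) →ₗ[k] ((N ⧸ defect k N) × N) :=
  LinearMap.mk₂ k
    (fun a b => (quotMul k N a.1 b.1, leftAct k N a.1 b.2 + rightAct k N a.2 b.1))
    (fun a a' b => by ext <;> simp; abel)
    (fun c a b => by ext <;> simp)
    (fun a b b' => by ext <;> simp; abel)
    (fun c a b => by ext <;> simp)

variable {k N}

theorem extMul_mk (x x' y y' : N) :
    extMul k N ((defect k N).mkQ x, x') ((defect k N).mkQ y, y') =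
      ((defect k N).mkQ (vdash (k := k) x y),
        vdash (k := k) x y' + dashv (k := k) x' y) := rfl

theorem mkQ_dashv (x y : N) : (defect k N).mkQ (dashv (k := k) x y) =
    (defect k N).mkQ (vdash (k := k) x y) :=
  ((Submodule.Quotient.eq _).mpr (sub_mem_defect x y)).symm

/-- Modulo `defect` the two operations agree, giving a Novikov quotient; in the second component
each identity splits into dialgebra identities according to which argument comes from `N`. -/
theorem isNovikov_extMul : IsNovikov (extMul k N) where
  lsymm := by
    rintro ⟨x, x'⟩ ⟨y, y'⟩ ⟨z, z'⟩
    obtain ⟨x, rfl⟩ := (defect k N).mkQ_surjective x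
    obtain ⟨y, rfl⟩ := (defect k N).mkQ_surjective y
    obtain ⟨z, rfl⟩ := (defect k N).mkQ_surjective z
    simp only [extMul_mk]
    refine Prod.ext ?_ ?_
    · simp only [Prod.fst_sub, ← map_sub, lsymm_right]
    · have e₁ := lsymm_right (k := k) x y z'
      have e₂ := lsymm_left (k := k) x' y z
      have e₃ := lsymm_left (k := k) y' x z
      have e₄ := zero_right (k := k) x' y z
      have e₅ := zero_right (k := k) y' x z
      simp only [Prod.snd_sub, map_add, LinearMap.add_apply]
      linear_combination (norm := abel) e₁ + e₂ - e₃ - e₄ + e₅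
  rcomm := by
    rintro ⟨x, x'⟩ ⟨y, y'⟩ ⟨z, z'⟩
    obtain ⟨x, rfl⟩ := (defect k N).mkQ_surjective x
    obtain ⟨y, rfl⟩ := (defect k N).mkQ_surjective y
    obtain ⟨z, rfl⟩ := (defect k N).mkQ_surjective z
    simp only [extMul_mk]
    refine Prod.ext ?_ ?_
    · rw [← rcomm_right, mkQ_dashv]
    · have e₁ := rcomm_left (k := k) x' y z
      have e₂ := rcomm_right (k := k) x y' z
      have e₃ := rcomm_right (k := k) x z' y
      simp only [map_add, LinearMap.add_apply]
      linear_combination (norm := abel) e₁ + e₂ - e₃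

end NovikovDialgebra

/-! ### From commutative algebras to Perm-algebras -/

/-- The square of a commutative algebra `C` with the product `(a, b) (c, e) = (a c, a e)`. -/
@[ext]
structure PermDouble (C : Type*) where
  /-- The first component. -/
  fst : C
  /-- The second component. -/
  snd : C

namespace PermDouble

variable {C : Type*}

/-- The underlying pair. -/
def equivProd : PermDouble C ≃ C × C where
  toFun x := (x.fst, x.snd)
  invFun x := ⟨x.1, x.2⟩

variable [CommRing C]

instance : AddCommGroup (PermDouble C) := equivProd.addCommGroup

instance : Mul (PermDouble C) := ⟨fun x y => ⟨x.fst * y.fst, x.fst * y.snd⟩⟩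

theorem mk_add_mk (a b c e : C) : (⟨a, b⟩ + ⟨c, e⟩ : PermDouble C) = ⟨a + c, b + e⟩ := rfl

theorem mk_mul_mk (a b c e : C) : (⟨a, b⟩ * ⟨c, e⟩ : PermDouble C) = ⟨a * c, a * e⟩ := rfl

theorem zero_def : (0 : PermDouble C) = ⟨0, 0⟩ := rfl

instance : PermRing (PermDouble C) where
  left_distrib := by
    rintro ⟨⟩ ⟨⟩ ⟨⟩
    simp only [mk_add_mk, mk_mul_mk, mul_add]
  right_distrib := by
    rintro ⟨⟩ ⟨⟩ ⟨⟩
    simp only [mk_add_mk, mk_mul_mk, add_mul]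
  zero_mul := by
    rintro ⟨⟩
    simp only [zero_def, mk_mul_mk, zero_mul]
  mul_zero := by
    rintro ⟨⟩
    simp only [zero_def, mk_mul_mk, mul_zero]
  mul_assoc := by
    rintro ⟨⟩ ⟨⟩ ⟨⟩
    simp only [mk_mul_mk, mul_assoc]
  left_comm' := by
    rintro ⟨a, _⟩ ⟨b, _⟩ ⟨⟩
    simp only [mk_mul_mk, mul_comm a b]

variable {k : Type*} [Field k] [Algebra k C]

instance : Module k (PermDouble C) := equivProd.module k

theorem smul_mk (c : k) (a b : C) : c • (⟨a, b⟩ : PermDouble C) = ⟨c • a, c • b⟩ := rfl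

instance : PermAlgebra k (PermDouble C) where
  toModule := inferInstance
  smul_assoc := by
    rintro c ⟨⟩ ⟨⟩
    simp only [smul_mk, smul_eq_mul, mk_mul_mk, smul_mul_assoc]
  smul_comm := by
    rintro c ⟨⟩ ⟨⟩
    simp only [smul_mk, smul_eq_mul, mk_mul_mk, mul_smul_comm]

/-- The componentwise derivation. -/
def derivation (d : Derivation k C C) : PermDerivation k (PermDouble C) where
  toFun x := ⟨d x.fst, d x.snd⟩
  map_add' := by
    rintro ⟨⟩ ⟨⟩
    simp only [mk_add_mk, map_add]
  map_smul' := by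
    rintro c ⟨⟩
    simp only [smul_mk, Derivation.map_smul, RingHom.id_apply]
  leibniz' := by
    rintro ⟨a, b⟩ ⟨c, e⟩
    simp only [mk_mul_mk, mk_add_mk, Derivation.leibniz, smul_eq_mul]
    congr 1 <;> ring

end PermDouble

/-! ### The two directions of the equivalence -/

/-- A differential `Perm`-algebra is a Novikov dialgebra with `x ⊢ y = x d(y)` and
`x ⊣ y = d(y) x`. -/
abbrev PermDerivation.novikovDialgebra {k P : Type*} [Field k] [PermRing P] [PermAlgebra k P]
    (d : PermDerivation k P) : NovikovDialgebra k P :=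
  have hd (x y : P) : d.toLinearMap (x * y) = d.toLinearMap x * y + x * d.toLinearMap y :=
    d.leibniz' x y
  have hc (x y z : P) : x * (y * z) = y * (x * z) := by
    rw [← mul_assoc, PermRing.left_comm', mul_assoc]
  { vdash := (LinearMap.mul k P).compl₂ d.toLinearMap
    dashv := ((LinearMap.mul k P).comp d.toLinearMap).flip
    zero_left := fun x y z => by
      simp only [LinearMap.compl₂_apply, LinearMap.flip_apply, LinearMap.comp_apply,
        LinearMap.mul_apply', PermRing.left_comm']
    zero_right := fun x y z => by
      simp only [LinearMap.compl₂_apply, LinearMap.flip_apply, LinearMap.comp_apply,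
        LinearMap.mul_apply', hd, add_mul, mul_assoc]
      rw [hc (d.toLinearMap z), hc y, add_comm]
    lsymm_left := fun x y z => by
      simp only [LinearMap.compl₂_apply, LinearMap.flip_apply, LinearMap.comp_apply,
        LinearMap.mul_apply', hd, add_mul, mul_add, mul_assoc]
      rw [hc (d.toLinearMap z) y, hc (d.toLinearMap (d.toLinearMap z)) y]
      abel
    lsymm_right := fun x y z => by
      simp only [LinearMap.compl₂_apply, LinearMap.mul_apply', hd, mul_add, mul_assoc]
      rw [hc x y]
      abel
    rcomm_left := fun x y z => by
      simp only [LinearMap.flip_apply, LinearMap.comp_apply, LinearMap.mul_apply']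
      exact hc _ _ _
    rcomm_right := fun x y z => by
      simp only [LinearMap.compl₂_apply, LinearMap.flip_apply, LinearMap.comp_apply,
        LinearMap.mul_apply', mul_assoc]
      exact hc _ _ _ }

theorem mainTheorem7 (k : Type u) [Field k] (A : Type v) [LeftPreLieRing A]
    [LeftPreLieAlgebra k A] :
    EmbedsInDifferentialPermAlgebra.{u, v, w} k A ↔ EmbedsInNovikovDialgebra.{u, v, w} k A := by
  constructor
  · rintro ⟨P, _, _, d, f, hf, h⟩
    exact ⟨P, inferInstance, inferInstance, d.novikovDialgebra, f, hf, h⟩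
  · rintro ⟨N, _, _, _, f, hf, h⟩
    obtain ⟨C, _, _, d, g, hg, hgm⟩ := Novikov.exists_embedding.{u, max v w}
      (NovikovDialgebra.isNovikov_extMul (k := k) (N := N))
    let q := (NovikovDialgebra.defect k N).mkQ
    refine ⟨PermDouble C, inferInstance, inferInstance, PermDouble.derivation d,
      { toFun := fun a => ⟨g (q (f a), 0), g (0, f a)⟩
        map_add' := fun a b => ?_
        map_smul' := fun c a => ?_ }, fun a b hab => ?_, fun a b => ?_⟩
    · rw [PermDouble.mk_add_mk, ← map_add, ← map_add]
      simp
    · rw [RingHom.id_apply, PermDouble.smul_mk, ← map_smul, ← map_smul]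
      simp
    -- The second coordinate alone recovers `f a`; the first one, which forgets `defect`, serves
    -- only to act.
    · exact hf (Prod.ext_iff.mp (hg (congrArg PermDouble.snd hab))).2
    · refine PermDouble.ext ?_ ?_
      · refine (congrArg g ?_).trans (hgm (q (f a), 0) (q (f b), 0))
        rw [NovikovDialgebra.extMul_mk, h]
        simp [q]
      · refine (congrArg g ?_).trans (hgm (q (f a), 0) (0, f b))
        rw [← map_zero q, NovikovDialgebra.extMul_mk, h]
        simp [q]
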